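/- Let $L=\{x\$x^{T}\mid x\in\{0,1\}^*\}$ be the language of marked binary palindromes over the alphabet $\{0,1,\$\}$, where $x^{T}$ denotes the reversal of $x$. Then $L$ can be accepted in $O(n^2/\log n)$ steps by a two-counter machine. That is, there are a deterministic two-counter machine $M$ and a function $t:\mathbb N\to\mathbb N$ with $t(n)=O(n^2/\log n)$ as $n\to\infty$ such that $M$ accepts exactly the words of $L$ and, on every input word over $\{0,1,\$\}$ of length $n$, whether accepted or not, $M$ halts after at most $t(n)$ steps. Here a deterministic $k$-counter machine has a finite set of states, a single two-way read-only head on an input tape bordered by a left and a right end-marker, and $k$ counters holding non-negative integers of unbounded size. It starts in its initial state with the head on the square next to the left end-marker and with all counters zero. In each step, depending on its state, the tape symbol scanned and on which counters are zero, it either has no move, or it enters a new state, moves the head by at most one square, and changes each counter by $-1$, $0$ or $1$. It never moves beyond an end-marker and never decrements a zero counter (if its program asks for this, it halts). It accepts the input by entering a final state, upon which it halts; a computation that halts in any other state rejects. -/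

import Mathlib

open Filter Asymptotics

/-- What a two-way head can read on a tape over `Γ`: one of the two end-markers or a symbol. -/
inductive TapeSymbol (Γ : Type) : Type
  | leftEnd : TapeSymbol Γ
  | symbol (a : Γ) : TapeSymbol Γ
  | rightEnd : TapeSymbol Γ

/-- The content of a tape square. The input `w` of length `n` occupies the squares `1, …, n`,
the end-markers are on the squares `0` and `n + 1`. -/
def tapeAt {Γ : Type} (w : List Γ) : ℕ → TapeSymbol Γ
  | 0 => TapeSymbol.leftEnd
  | p + 1 =>
    match w[p]? with
    | some a => TapeSymbol.symbol a
    | none => TapeSymbol.rightEnd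

/-- A deterministic counter machine with one two-way read-only input head and `k` counters.
In one step, depending on the state, on the tape symbol read and on which of the counters are
zero (`true` means zero), it either has no move (`none`) or it goes to a new state, moves
the head by `-1`, `0` or `1` squares, and adds `-1`, `0` or `1` to each counter. -/
structure CounterMachine (k : ℕ) (Γ : Type) where
  State : Type
  finite_state : Finite State
  start : State
  accept : Set State
  trans : State → TapeSymbol Γ → (Fin k → Bool) →
    Option (State × SignType × (Fin k → SignType))

namespace CounterMachine

variable {k : ℕ} {Γ : Type}

/-- A configuration: state, head position, and contents of the counters. -/
@[ext]
structure Config (M : CounterMachine k Γ) where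
  state : M.State
  pos : ℕ
  counter : Fin k → ℕ

/-- The head starts next to the left end-marker, all counters are zero. -/
def init (M : CounterMachine k Γ) : M.Config where
  state := M.start
  pos := 1
  counter := fun _ => 0

/-- One step on input `w`. There is no step from a final state, nor one that
would move the head beyond an end-marker or decrement a counter that is zero. -/
def Step (M : CounterMachine k Γ) (w : List Γ) (c c' : M.Config) : Prop :=
  c.state ∉ M.accept ∧
  ∃ (move : SignType) (op : Fin k → SignType),
    M.trans c.state (tapeAt w c.pos) (fun i => decide (c.counter i = 0)) =
      some (c'.state, move, op) ∧
    (c'.pos : ℤ) = (c.pos : ℤ) + (move : ℤ) ∧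
    c'.pos ≤ w.length + 1 ∧
    ∀ i, (c'.counter i : ℤ) = (c.counter i : ℤ) + (op i : ℤ)

/-- `M.ReachesIn w s c c'`: on input `w`, exactly `s` steps lead from `c` to `c'`. -/
def ReachesIn (M : CounterMachine k Γ) (w : List Γ) : ℕ → M.Config → M.Config → Prop
  | 0, c, c' => c = c'
  | s + 1, c, c' => ∃ d, M.Step w c d ∧ M.ReachesIn w s d c'

/-- `M` accepts `w` if it enters a final state. -/
def Accepts (M : CounterMachine k Γ) (w : List Γ) : Prop :=
  ∃ (s : ℕ) (c : M.Config), M.ReachesIn w s M.init c ∧ c.state ∈ M.accept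

/-- On input `w`, `M` halts after at most `T` steps. -/
def HaltsWithin (M : CounterMachine k Γ) (w : List Γ) (T : ℕ) : Prop :=
  ∃ s ≤ T, ∃ c : M.Config, M.ReachesIn w s M.init c ∧ ∀ d, ¬ M.Step w c d

/-- The language accepted by `M`. -/
def language (M : CounterMachine k Γ) : Language Γ :=
  {w | M.Accepts w}

/-- On every input of length `n` (accepted or not), `M` halts after at most `t n` steps. -/
def RunsInTime (M : CounterMachine k Γ) (t : ℕ → ℕ) : Prop :=
  ∀ w : List Γ, M.HaltsWithin w (t w.length)

end CounterMachine

/-- The alphabet `{0, 1, $}`. -/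
inductive MarkedBit : Type
  | bit (b : Bool) : MarkedBit
  | marker : MarkedBit

/-- The language `{x $ xᵀ | x ∈ {0, 1}*}` of marked palindromes. -/
def markedPalindromes : Language MarkedBit :=
  {w | ∃ x : List Bool,
    w = x.map MarkedBit.bit ++ MarkedBit.marker :: x.reverse.map MarkedBit.bit}

/-! Comparing mirror squares one pair at a time costs about n^2 steps. The saving comes from
carrying a block of about log n bits across the marker per journey, stored as a number of size O(n)
in one counter.

Once the shape is checked (one marker, m bits on each side), a block is read into the first counter
as its `code`: a leading one followed by the bits. Appending a bit doubles the counter; the second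
counter receives the double, while the head, displaced by the old value, remembers through the
second counter how to return. The block ends at the marker, or when the displacement would leave the
tape, so that the code exceeds m + 1 and the block has at least log m bits (`exists_block`). The
costs of the doublings form a geometric sum, hence a block is read in O(m) steps.

The second counter then carries the distance to the marker over to the other side. Repeated halving
pops the bits last-in first-out, and each is compared with the scanned mirror bit (`verify_run`),
again at geometric cost. The head returns by the same distance trick to the start of the block;
since the code has been consumed, the block is read again merely to find its end (`block_run`). All
but the last block have at least log m bits, so there are O(m / log m) rounds of O(m) steps
(`blocks_run`). -/

namespace CounterMachine

/-! ### Deterministic runs and their composition with time bounds -/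

variable {k : ℕ} {Γ : Type} {M : CounterMachine k Γ} {w : List Γ}

theorem Step.unique {c d d' : M.Config} (h : M.Step w c d) (h' : M.Step w c d') : d = d' := by
  obtain ⟨-, mv, op, ht, hp, -, hc⟩ := h
  obtain ⟨-, mv', op', ht', hp', -, hc'⟩ := h'
  rw [ht] at ht'
  simp only [Option.some.injEq, Prod.mk.injEq] at ht'
  obtain ⟨hs, rfl, rfl⟩ := ht'
  ext i
  · exact hs
  · omega
  · have h1 := hc i
    have h2 := hc' i
    omega

theorem ReachesIn.trans {s s' : ℕ} {c d e : M.Config} (h : M.ReachesIn w s c d)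
    (h' : M.ReachesIn w s' d e) : M.ReachesIn w (s + s') c e := by
  induction s generalizing c with
  | zero => cases h; simpa using h'
  | succ s ih =>
    obtain ⟨b, hb, h⟩ := h
    rw [Nat.add_right_comm]
    exact ⟨b, hb, ih h⟩

/-- A computation has at most one halting configuration. -/
theorem ReachesIn.halt_unique {s s' : ℕ} {c d d' : M.Config} (h : M.ReachesIn w s c d)
    (h' : M.ReachesIn w s' c d') (hd : ∀ e, ¬ M.Step w d e) (hd' : ∀ e, ¬ M.Step w d' e) :
    d = d' := by
  induction s generalizing c s' with
  | zero =>
    cases h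
    cases s' with
    | zero => exact h'
    | succ s' => obtain ⟨b, hb, -⟩ := h'; exact absurd hb (hd b)
  | succ s ih =>
    obtain ⟨b, hb, h⟩ := h
    cases s' with
    | zero => cases h'; exact absurd hb (hd' b)
    | succ s' =>
      obtain ⟨b', hb', h'⟩ := h'
      cases hb.unique hb'
      exact ih h h'

/-- `c'` is reached from `c` in at most `T` steps. -/
def ReachesWithin (M : CounterMachine k Γ) (w : List Γ) (T : ℕ) (c c' : M.Config) : Prop :=
  ∃ s ≤ T, M.ReachesIn w s c c'

/-- From `c` the machine halts within `T` steps, in a final state if and only if `P`. -/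
def Decides (M : CounterMachine k Γ) (w : List Γ) (T : ℕ) (c : M.Config) (P : Prop) : Prop :=
  ∃ d, M.ReachesWithin w T c d ∧ (∀ e, ¬ M.Step w d e) ∧ (d.state ∈ M.accept ↔ P)

theorem ReachesWithin.refl {T : ℕ} (c : M.Config) : M.ReachesWithin w T c c :=
  ⟨0, Nat.zero_le _, rfl⟩

theorem Step.reachesWithin {c d : M.Config} (h : M.Step w c d) : M.ReachesWithin w 1 c d :=
  ⟨1, le_rfl, d, h, rfl⟩

theorem ReachesWithin.trans {T T' : ℕ} {c d e : M.Config} (h : M.ReachesWithin w T c d)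
    (h' : M.ReachesWithin w T' d e) : M.ReachesWithin w (T + T') c e := by
  obtain ⟨s, hs, h⟩ := h
  obtain ⟨s', hs', h'⟩ := h'
  exact ⟨s + s', by omega, h.trans h'⟩

theorem ReachesWithin.mono {T T' : ℕ} {c d : M.Config} (h : M.ReachesWithin w T c d)
    (hT : T ≤ T') : M.ReachesWithin w T' c d := by
  obtain ⟨s, hs, h⟩ := h
  exact ⟨s, hs.trans hT, h⟩

theorem ReachesWithin.decides {T T' : ℕ} {c d : M.Config} {P : Prop}
    (h : M.ReachesWithin w T c d) (h' : M.Decides w T' d P) : M.Decides w (T + T') c P := by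
  obtain ⟨e, he, hs⟩ := h'
  exact ⟨e, h.trans he, hs⟩

theorem Decides.mono {T T' : ℕ} {c : M.Config} {P : Prop} (h : M.Decides w T c P)
    (hT : T ≤ T') : M.Decides w T' c P := by
  obtain ⟨e, he, hs⟩ := h
  exact ⟨e, he.mono hT, hs⟩

theorem Decides.congr {T : ℕ} {c : M.Config} {P Q : Prop} (h : M.Decides w T c P)
    (hPQ : P ↔ Q) : M.Decides w T c Q := by
  rwa [← propext hPQ]

theorem Decides.haltsWithin {T : ℕ} {P : Prop} (h : M.Decides w T M.init P) :
    M.HaltsWithin w T := by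
  obtain ⟨e, ⟨s, hs, he⟩, hh, -⟩ := h
  exact ⟨s, hs, e, he, hh⟩

theorem Decides.accepts_iff {T : ℕ} {P : Prop} (h : M.Decides w T M.init P) :
    M.Accepts w ↔ P := by
  obtain ⟨e, ⟨s, hs, he⟩, hh, hP⟩ := h
  rw [← hP]
  constructor
  · rintro ⟨s', c, hc, hacc⟩
    rwa [he.halt_unique hc hh fun _ hst => hst.1 hacc]
  · exact fun hacc => ⟨s, e, he, hacc⟩

end CounterMachine

/-! ### The machine -/

namespace MarkedPalindrome

open CounterMachine TapeSymbol MarkedBit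

/-- The states of the machine for marked palindromes. The flag of `readBlock`, `double` and `back`
tells whether the block that is read will be compared (`true`) or skipped (`false`). -/
inductive State : Type
  | countLeft | countRight | rewind | blockStart
  | readBlock (f : Bool)
  | double (f b : Bool) | double' (f b : Bool)
  | back (f : Bool) (r : Option Bool) | back' (f : Bool) (r : Option Bool)
  | clear | toMiddle | fromMiddle
  | halve | halve' | copy
  | returnToMiddle | returnFromMiddle
  | accepting
  deriving Fintype

open State

/-- The state entered when a block has been read. -/
def blockEnd (f : Bool) : State := if f then toMiddle else clear

/-- The program. The two Boolean arguments tell which counters are zero. -/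
def program : State → TapeSymbol MarkedBit → Bool → Bool →
    Option (State × SignType × SignType × SignType)
  | countLeft, symbol (bit _), _, _ => some (countLeft, 1, 1, 0)
  | countLeft, symbol marker, _, _ => some (countRight, 1, 0, 0)
  | countRight, symbol (bit _), false, _ => some (countRight, 1, -1, 0)
  | countRight, rightEnd, true, _ => some (rewind, -1, 0, 0)
  | rewind, symbol _, _, _ => some (rewind, -1, 0, 0)
  | rewind, leftEnd, _, _ => some (blockStart, 1, 0, 0)
  | blockStart, symbol marker, _, _ => some (accepting, 0, 0, 0)
  | blockStart, symbol (bit _), _, _ => some (readBlock true, 0, 1, 0)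
  | readBlock f, symbol marker, _, _ => some (blockEnd f, 0, 0, 0)
  | readBlock f, symbol (bit b), _, _ => some (double f b, 0, 0, 0)
  | double f b, _, true, _ => some (back f (some b), 0, 0, 0)
  -- The tape is too short for another doubling: the block is full, and the way back restores the
  -- old code instead of the doubled one.
  | double f _, rightEnd, false, _ => some (back f none, 0, 0, 0)
  | double f b, symbol _, false, _ => some (double' f b, 1, -1, 1)
  | double' f b, _, _, _ => some (double f b, 0, 0, 1)
  | back f r, _, _, false => some (back' f r, -1, if r.isSome then 1 else 0, -1)
  | back' f r, _, _, _ => some (back f r, 0, 1, -1)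
  | back f none, _, _, true => some (blockEnd f, 0, 0, 0)
  | back f (some b), _, _, true => some (readBlock f, 1, if b then 1 else 0, 0)
  | clear, _, false, _ => some (clear, 0, -1, 0)
  | clear, _, true, _ => some (blockStart, 0, 0, 0)
  | toMiddle, symbol (bit _), _, _ => some (toMiddle, 1, 0, 1)
  | toMiddle, symbol marker, _, _ => some (fromMiddle, 0, 0, 0)
  | fromMiddle, _, _, false => some (fromMiddle, 1, 0, -1)
  | fromMiddle, _, _, true => some (halve, 1, 0, 0)
  | halve, _, false, _ => some (halve', 0, -1, 0)
  | halve', _, false, _ => some (halve, 0, -1, 1)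
  | halve, symbol (bit false), true, _ => some (copy, 1, 0, 0)
  | halve', symbol (bit true), true, false => some (copy, 1, 0, 0)
  -- Only the leading one was left, so the whole block has matched.
  | halve', _, true, true => some (returnToMiddle, -1, 0, 0)
  | copy, _, _, false => some (copy, 0, 1, -1)
  | copy, _, _, true => some (halve, 0, 0, 0)
  | returnToMiddle, symbol (bit _), _, _ => some (returnToMiddle, -1, 0, 1)
  | returnToMiddle, symbol marker, _, _ => some (returnFromMiddle, 0, 0, 0)
  | returnFromMiddle, _, _, false => some (returnFromMiddle, -1, 0, -1)
  -- The comparison used up the code; a second reading recovers where the block ended.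
  | returnFromMiddle, _, _, true => some (readBlock false, 0, 1, 0)
  | _, _, _, _ => none

/-- The two-counter machine for marked palindromes. -/
def machine : CounterMachine 2 MarkedBit where
  State := State
  finite_state := inferInstance
  start := countLeft
  accept := {accepting}
  trans q a z := (program q a (z 0) (z 1)).map fun r => (r.1, r.2.1, ![r.2.2.1, r.2.2.2])

/-- The configuration with given state, head position and counters. -/
def cfg (q : State) (p a b : ℕ) : machine.Config := ⟨q, p, ![a, b]⟩

theorem init_eq : machine.init = cfg countLeft 1 0 0 := by
  ext i
  · rfl
  · rfl
  · fin_cases i <;> rfl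

variable {w : List MarkedBit}

theorem reaches_step {q q' : State} {p p' a a' b b' : ℕ} {mv oa ob : SignType}
    (ht : program q (tapeAt w p) (decide (a = 0)) (decide (b = 0)) = some (q', mv, oa, ob))
    (hq : q ≠ accepting) (hle : p' ≤ w.length + 1) (hp : (p' : ℤ) = p + (mv : ℤ))
    (ha : (a' : ℤ) = a + (oa : ℤ)) (hb : (b' : ℤ) = b + (ob : ℤ)) :
    machine.ReachesWithin w 1 (cfg q p a b) (cfg q' p' a' b') := by
  refine Step.reachesWithin ⟨hq, mv, ![oa, ob], ?_, hp, hle, ?_⟩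
  · change (program _ _ _ _).map _ = _
    exact congrArg (Option.map _) ht
  · intro i
    fin_cases i
    · exact ha
    · exact hb

theorem decides_of_stuck {q : State} {p a b T : ℕ} {P : Prop}
    (ht : program q (tapeAt w p) (decide (a = 0)) (decide (b = 0)) = none)
    (hq : q ≠ accepting) (hP : ¬ P) : machine.Decides w T (cfg q p a b) P := by
  refine ⟨_, ReachesWithin.refl _, ?_, ?_⟩
  · rintro d ⟨-, mv, op, h, -⟩
    change (program q (tapeAt w p) (decide (a = 0)) (decide (b = 0))).map _ = _ at h
    rw [ht] at h
    exact absurd h (by simp)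
  · exact ⟨fun h => absurd h hq, fun h => absurd h hP⟩

theorem decides_accept {p a b T : ℕ} {P : Prop} (hP : P) :
    machine.Decides w T (cfg accepting p a b) P :=
  ⟨_, ReachesWithin.refl _, fun _ h => h.1 rfl, fun _ => hP, fun _ => rfl⟩

/-! ### The shape of the input -/

theorem tapeAt_append (l₁ : List MarkedBit) (a : MarkedBit) (l₂ : List MarkedBit) :
    tapeAt (l₁ ++ a :: l₂) (l₁.length + 1) = symbol a := by
  simp [tapeAt]

theorem tapeAt_length_add_one (w : List MarkedBit) : tapeAt w (w.length + 1) = rightEnd := by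
  simp [tapeAt]

theorem exists_tapeAt_eq_symbol {p : ℕ} (h1 : 1 ≤ p) (h2 : p ≤ w.length) :
    ∃ s, tapeAt w p = symbol s := by
  obtain ⟨p, rfl⟩ := Nat.exists_eq_add_of_le' h1
  exact ⟨w[p], by simp [tapeAt, List.getElem?_eq_getElem (show p < w.length by omega)]⟩

/-- The tape is split as `pre ++ l` so that the induction on the unread part `l` knows the head
position. -/
theorem countLeft_run (l pre : List MarkedBit) (a : ℕ) (hw : w = pre ++ l) :
    (∃ (x : List Bool) (r : List MarkedBit), l = x.map bit ++ marker :: r ∧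
      machine.ReachesWithin w (x.length + 1) (cfg countLeft (pre.length + 1) a 0)
        (cfg countRight (pre.length + x.length + 2) (a + x.length) 0)) ∨
    (marker ∉ l ∧
      machine.Decides w l.length (cfg countLeft (pre.length + 1) a 0) False) := by
  induction l generalizing pre a with
  | nil =>
    right
    refine ⟨by simp, decides_of_stuck ?_ (by simp) id⟩
    rw [show pre.length = w.length by simp [hw], tapeAt_length_add_one]
    rfl
  | cons s l ih =>
    have hs : tapeAt w (pre.length + 1) = symbol s := by rw [hw, tapeAt_append]
    have hl : pre.length + 1 ≤ w.length := by simp [hw]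
    cases s with
    | marker =>
      left
      exact ⟨[], l, rfl, reaches_step (by rw [hs]; rfl) (by simp) (by simp; omega)
        (by simp; ring) (by simp) (by simp)⟩
    | bit b =>
      have h1 : machine.ReachesWithin w 1 (cfg countLeft (pre.length + 1) a 0)
          (cfg countLeft ((pre ++ [bit b]).length + 1) (a + 1) 0) :=
        reaches_step (by rw [hs]; rfl) (by simp) (by simp; omega) (by simp) (by simp) (by simp)
      rcases ih (pre ++ [bit b]) (a + 1) (by simp [hw]) with ⟨x, r, rfl, h⟩ | ⟨h, h'⟩
      · left
        refine ⟨b :: x, r, rfl, ?_⟩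
        convert (h1.trans h).mono (T' := (b :: x).length + 1) (by simp; omega) using 2
        · simp; omega
        · simp; omega
      · right
        exact ⟨by simp [h], (h1.decides h').mono (by simp; omega)⟩

theorem countRight_run (l pre : List MarkedBit) (a : ℕ) (hw : w = pre ++ l) :
    (∃ y : List Bool, l = y.map bit ∧ y.length = a ∧
      machine.ReachesWithin w (l.length + 1) (cfg countRight (pre.length + 1) a 0)
        (cfg rewind w.length 0 0)) ∨
    ((¬ ∃ y : List Bool, l = y.map bit ∧ y.length = a) ∧
      machine.Decides w l.length (cfg countRight (pre.length + 1) a 0) False) := by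
  induction l generalizing pre a with
  | nil =>
    have hs : tapeAt w (pre.length + 1) = rightEnd := by
      rw [show pre.length = w.length by simp [hw], tapeAt_length_add_one]
    cases a with
    | zero =>
      left
      exact ⟨[], rfl, rfl, reaches_step (by rw [hs]; rfl) (by simp) (by simp)
        (by simp [hw]) (by simp) (by simp)⟩
    | succ a =>
      right
      refine ⟨?_, decides_of_stuck (by rw [hs]; simp [program]) (by simp) id⟩
      rintro ⟨y, hy, h⟩
      simp at hy
      simp [hy] at h
  | cons s l ih =>
    have hs : tapeAt w (pre.length + 1) = symbol s := by rw [hw, tapeAt_append]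
    have hl : pre.length + 1 ≤ w.length := by simp [hw]
    cases s with
    | marker =>
      right
      refine ⟨?_, decides_of_stuck (by rw [hs]; simp [program]) (by simp) id⟩
      rintro ⟨y, hy, -⟩
      cases y <;> simp at hy
    | bit b =>
      cases a with
      | zero =>
        right
        refine ⟨?_, decides_of_stuck (by rw [hs]; simp [program]) (by simp) id⟩
        rintro ⟨y, hy, h⟩
        simp at h
        simp [h] at hy
      | succ a =>
        have h1 : machine.ReachesWithin w 1 (cfg countRight (pre.length + 1) (a + 1) 0)
            (cfg countRight ((pre ++ [bit b]).length + 1) a 0) :=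
          reaches_step (by rw [hs]; rfl) (by simp) (by simp; omega) (by simp) (by simp) (by simp)
        rcases ih (pre ++ [bit b]) a (by simp [hw]) with ⟨y, rfl, h, h'⟩ | ⟨h, h'⟩
        · left
          exact ⟨b :: y, rfl, by simp [h], (h1.trans h').mono (by simp; omega)⟩
        · right
          refine ⟨?_, (h1.decides h').mono (by simp; omega)⟩
          rintro ⟨_ | ⟨b', y⟩, hy, hlen⟩
          · simp at hlen
          · simp only [List.map_cons, List.cons.injEq] at hy
            exact h ⟨y, hy.2, by simpa using hlen⟩

theorem rewind_run (p : ℕ) (hp : p ≤ w.length) :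
    machine.ReachesWithin w (p + 1) (cfg rewind p 0 0) (cfg blockStart 1 0 0) := by
  induction p with
  | zero => exact reaches_step rfl (by simp) (by simp) (by simp) (by simp) (by simp)
  | succ p ih =>
    obtain ⟨s, hs⟩ := exists_tapeAt_eq_symbol (w := w) (Nat.le_add_left 1 p) hp
    have h1 : machine.ReachesWithin w 1 (cfg rewind (p + 1) 0 0) (cfg rewind p 0 0) :=
      reaches_step (by rw [hs]; rfl) (by simp) (by omega) (by simp) (by simp)
        (by simp)
    exact (h1.trans (ih (by omega))).mono (by omega)

/-- The input has the marker in the middle, at distance `m + 1` from both end-markers, and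
carries the bit `g p` on any other square `p`. -/
structure Balanced (w : List MarkedBit) (m : ℕ) (g : ℕ → Bool) : Prop where
  length : w.length = 2 * m + 1
  bit : ∀ p, 1 ≤ p → p ≤ 2 * m + 1 → p ≠ m + 1 → tapeAt w p = symbol (bit (g p))
  marker : tapeAt w (m + 1) = symbol marker

theorem map_bit_append_inj {x x' : List Bool} {r r' : List MarkedBit}
    (h : x.map bit ++ marker :: r = x'.map bit ++ marker :: r') : x = x' ∧ r = r' := by
  induction x generalizing x' with
  | nil => cases x' <;> simp_all
  | cons b x ih =>
    cases x' with
    | nil => simp at h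
    | cons b' x' =>
      simp only [List.map_cons, List.cons_append, List.cons.injEq, MarkedBit.bit.injEq] at h
      obtain ⟨rfl, rfl⟩ := ih h.2
      exact ⟨by rw [h.1], rfl⟩

theorem mem_markedPalindromes_iff {x : List Bool} {r : List MarkedBit} :
    x.map bit ++ marker :: r ∈ markedPalindromes ↔ r = x.reverse.map bit := by
  constructor
  · rintro ⟨x', h⟩
    obtain ⟨rfl, rfl⟩ := map_bit_append_inj h
    rfl
  · rintro rfl
    exact ⟨x, rfl⟩

theorem exists_balanced {x y : List Bool} (hxy : y.length = x.length) :
    ∃ g : ℕ → Bool, Balanced (x.map bit ++ marker :: y.map bit) x.length g ∧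
      (x.map bit ++ marker :: y.map bit ∈ markedPalindromes ↔
        ∀ i, 1 ≤ i → i < x.length + 1 → g i = g (2 * x.length + 2 - i)) := by
  -- Squares count from 1 and the marker occupies one of them, so `y` begins on square `x.length +
  -- 2`. The default `false` matters on no bit square.
  refine ⟨fun p => if p ≤ x.length then x.getD (p - 1) false
    else y.getD (p - x.length - 2) false, ⟨?_, ?_, ?_⟩, ?_⟩
  · simp; omega
  · intro p h1 h2 h3
    obtain ⟨p, rfl⟩ := Nat.exists_eq_add_of_le' h1
    by_cases hp : p < x.length
    · simp [tapeAt, List.getElem?_append, hp]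
    · obtain ⟨j, rfl⟩ : ∃ j, p = x.length + 1 + j := ⟨p - x.length - 1, by omega⟩
      have hj : j < y.length := by omega
      have e1 : x.length + 1 + j - x.length = j + 1 := by omega
      have e2 : x.length + 1 + j + 1 - x.length - 2 = j := by omega
      have e3 : ¬ x.length + 1 + j + 1 ≤ x.length := by omega
      simp [tapeAt, List.getElem?_append, hp, e1, e2, e3, hj]
  · simp [tapeAt]
  · rw [mem_markedPalindromes_iff,
      (List.map_injective_iff.2 fun _ _ h => MarkedBit.bit.inj h).eq_iff]
    constructor
    · rintro rfl i h1 h2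
      have e1 : i ≤ x.length := by omega
      have e2 : ¬ 2 * x.length + 2 - i ≤ x.length := by omega
      have e3 : 2 * x.length + 2 - i - x.length - 2 = x.length - i := by omega
      have e4 : x.length - i < x.length := by omega
      have e5 : x.length - 1 - (x.length - i) = i - 1 := by omega
      simp only [e1, e2, e3, if_true, if_false]
      have e6 : i - 1 < x.length := by omega
      simp [e4, e5, e6]
    · intro h
      refine List.ext_getElem (by simpa) fun j h1 h2 => ?_
      have := h (x.length - j) (by omega) (by omega)
      have e2 : ¬ 2 * x.length + 2 - (x.length - j) ≤ x.length := by omega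
      have e3 : 2 * x.length + 2 - (x.length - j) - x.length - 2 = j := by omega
      have e4 : x.length - j - 1 < x.length := by omega
      have e5 : x.length - 1 - j = x.length - j - 1 := by omega
      simp only [Nat.sub_le, e2, e3, if_true, if_false] at this
      simp only [List.getD_eq_getElem?_getD, List.getElem?_eq_getElem e4,
        List.getElem?_eq_getElem h1, Option.getD_some] at this
      rw [List.getElem_reverse]
      simp only [e5]
      exact this.symm

/-! ### Reading a block -/

/-- Two steps per square, because a counter changes by at most one per step. -/
theorem double_run (f b : Bool) (i p a c : ℕ) (hp : 1 ≤ p) (h : p + i ≤ w.length + 1) :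
    machine.ReachesWithin w (2 * i) (cfg (double f b) p (i + a) c)
      (cfg (double f b) (p + i) a (c + 2 * i)) := by
  induction i generalizing p c with
  | zero => simpa using ReachesWithin.refl _
  | succ i ih =>
    obtain ⟨s, hs⟩ := exists_tapeAt_eq_symbol (w := w) hp (by omega)
    have h1 : machine.ReachesWithin w 1 (cfg (double f b) p (i + 1 + a) c)
        (cfg (double' f b) (p + 1) (i + a) (c + 1)) := by
      refine reaches_step (mv := 1) (oa := -1) (ob := 1) ?_ (by simp) (by omega) (by simp)
        (by simp; omega) (by simp)
      simp [hs, program]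
    have h2 : machine.ReachesWithin w 1 (cfg (double' f b) (p + 1) (i + a) (c + 1))
        (cfg (double f b) (p + 1) (i + a) (c + 2)) :=
      reaches_step (by simp only [program]; rfl) (by simp) (by omega) (by simp) (by simp)
        (by simp; omega)
    convert ((h1.trans h2).trans (ih (p + 1) (c + 2) (by omega) (by omega))).mono
      (T' := 2 * (i + 1)) (by omega) using 2 <;> omega

/-- The second counter holds twice the displacement, which brings the head back to its square;
adding two or one per square yields the doubled value or restores the old one. -/
theorem back_run (f : Bool) (r : Option Bool) (i p a : ℕ) (h : p + i ≤ w.length + 1) :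
    machine.ReachesWithin w (2 * i) (cfg (back f r) (p + i) a (2 * i))
      (cfg (back f r) p (a + if r.isSome then 2 * i else i) 0) := by
  induction i generalizing a with
  | zero => simpa using ReachesWithin.refl _
  | succ i ih =>
    have h1 : machine.ReachesWithin w 1 (cfg (back f r) (p + (i + 1)) a (2 * (i + 1)))
        (cfg (back' f r) (p + i) (a + if r.isSome then 1 else 0) (2 * i + 1)) := by
      refine reaches_step (mv := -1) (oa := if r.isSome then 1 else 0) (ob := -1) ?_ (by simp)
        (by omega) (by simp; omega) ?_ (by simp; omega)
      · simp [program]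
      · cases r <;> simp
    have h2 : machine.ReachesWithin w 1
        (cfg (back' f r) (p + i) (a + if r.isSome then 1 else 0) (2 * i + 1))
        (cfg (back f r) (p + i) (a + (if r.isSome then 1 else 0) + 1) (2 * i)) :=
      reaches_step (by simp only [program]; rfl) (by simp) (by omega) (by simp) (by simp)
        (by simp)
    convert ((h1.trans h2).trans (ih _ (by omega))).mono (T' := 2 * (i + 1)) (by omega) using 2
    cases r <;> simp <;> omega

/-- The number whose binary digits are a leading one and the `k` bits `g p, g (p + 1), …`. -/
def code (g : ℕ → Bool) (p : ℕ) : ℕ → ℕ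
  | 0 => 1
  | k + 1 => 2 * code g p k + (g (p + k)).toNat

theorem one_le_code (g : ℕ → Bool) (p k : ℕ) : 1 ≤ code g p k := by
  induction k with
  | zero => exact le_rfl
  | succ k ih => simp only [code]; omega

theorem code_lt_two_pow (g : ℕ → Bool) (p k : ℕ) : code g p k < 2 ^ (k + 1) := by
  induction k with
  | zero => simp [code]
  | succ k ih =>
    have := Bool.toNat_le (g (p + k))
    rw [pow_succ, code]
    omega

variable {m : ℕ} {g : ℕ → Bool}

namespace Balanced

theorem rightEnd (H : Balanced w m g) : tapeAt w (2 * m + 2) = rightEnd := by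
  rw [← tapeAt_length_add_one w, H.length]

theorem readBlock_bit (H : Balanced w m g) (f : Bool) {p v : ℕ} (hp : 1 ≤ p) (hpm : p ≤ m)
    (hv : p + v ≤ 2 * m + 2) :
    machine.ReachesWithin w (4 * v + 3) (cfg (readBlock f) p v 0)
      (cfg (readBlock f) (p + 1) (2 * v + (g p).toNat) 0) := by
  have hl := H.length
  have hs := H.bit p hp (by omega) (by omega)
  have h1 : machine.ReachesWithin w 1 (cfg (readBlock f) p v 0)
      (cfg (double f (g p)) p (v + 0) 0) :=
    reaches_step (by simp only [hs, program]; rfl) (by simp) (by omega) (by simp) (by simp)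
        (by simp)
  have h2 := double_run (w := w) f (g p) v p 0 0 hp (by omega)
  have h3 : machine.ReachesWithin w 1 (cfg (double f (g p)) (p + v) 0 (0 + 2 * v))
      (cfg (back f (some (g p))) (p + v) 0 (2 * v)) :=
    reaches_step (by simp [program]; exact ⟨rfl, rfl, rfl⟩) (by simp) (by omega) (by simp)
      (by simp) (by simp)
  have h4 := back_run (w := w) f (some (g p)) v p 0 (by omega)
  have h5 : machine.ReachesWithin w 1 (cfg (back f (some (g p))) p (0 + 2 * v) 0)
      (cfg (readBlock f) (p + 1) (2 * v + (g p).toNat) 0) := by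
    refine reaches_step (mv := 1) (oa := if g p then 1 else 0) (ob := 0) ?_ (by simp)
      (by omega) (by simp) ?_ (by simp)
    · simp [program]
    · cases g p <;> simp
  exact ((((h1.trans h2).trans h3).trans h4).trans h5).mono (by omega)

/-- Appending a bit to `v` costs `4 * v + 3` and at least doubles `v`, so the final code dominates
the geometric sum. -/
theorem readBlock_run (H : Balanced w m g) (f : Bool) {p : ℕ} (hp : 1 ≤ p) (k : ℕ)
    (hk : p + k ≤ m + 1) (hc : ∀ j < k, p + j + code g p j ≤ 2 * m + 2) :
    machine.ReachesWithin w (8 * code g p k) (cfg (readBlock f) p 1 0)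
      (cfg (readBlock f) (p + k) (code g p k) 0) := by
  induction k with
  | zero => exact ReachesWithin.refl _
  | succ k ih =>
    have h1 := ih (by omega) fun j hj => hc j (by omega)
    have h2 := H.readBlock_bit f (p := p + k) (by omega) (by omega) (hc k (by omega))
    have := one_le_code g p k
    exact (h1.trans h2).mono (by simp only [code]; omega)

/-- Besides the marker, the stopping condition is a failed doubling. The inequality is strict: a
displacement ending exactly on the right end-marker empties the counter and still succeeds. -/
theorem readBlock_end (H : Balanced w m g) (f : Bool) {q v : ℕ} (hq : 1 ≤ q) (hqm : q ≤ m + 1)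
    (h : q = m + 1 ∨ 2 * m + 2 < q + v) :
    machine.ReachesWithin w (8 * m + 11) (cfg (readBlock f) q v 0)
      (cfg (blockEnd f) q v 0) := by
  have hl := H.length
  by_cases hqe : q = m + 1
  · subst hqe
    exact (reaches_step (by simp only [H.marker, program]; rfl) (by simp) (by omega) (by simp)
      (by simp) (by simp)).mono (by omega)
  obtain ⟨i, hi⟩ : ∃ i, q + i = 2 * m + 2 := ⟨2 * m + 2 - q, by omega⟩
  obtain ⟨a, rfl⟩ : ∃ a, v = i + (a + 1) := ⟨v - i - 1, by omega⟩
  have hs := H.bit q hq (by omega) hqe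
  have h1 : machine.ReachesWithin w 1 (cfg (readBlock f) q (i + (a + 1)) 0)
      (cfg (double f (g q)) q (i + (a + 1)) 0) :=
    reaches_step (by simp only [hs, program]; rfl) (by simp) (by omega) (by simp) (by simp)
        (by simp)
  have h2 := double_run (w := w) f (g q) i q (a + 1) 0 hq (by omega)
  have h3 : machine.ReachesWithin w 1 (cfg (double f (g q)) (q + i) (a + 1) (0 + 2 * i))
      (cfg (back f none) (q + i) (a + 1) (2 * i)) :=
    reaches_step (by rw [hi, H.rightEnd]; rfl) (by simp) (by omega) (by simp)
      (by simp) (by simp)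
  have h4 := back_run (w := w) f none i q (a + 1) (by omega)
  have h5 : machine.ReachesWithin w 1 (cfg (back f none) q (a + 1 + i) 0)
      (cfg (blockEnd f) q (i + (a + 1)) 0) :=
    reaches_step (by simp [program]; exact ⟨rfl, rfl, rfl⟩) (by simp) (by omega) (by simp)
      (by simp; omega) (by simp)
  exact ((((h1.trans h2).trans h3).trans h4).trans h5).mono (by omega)

/-- The block read from square `p` has at least about `log m` bits unless it ends at the marker,
and its code is of linear size. -/
theorem exists_block (H : Balanced w m g) {p : ℕ} (hp : 1 ≤ p) (hpm : p ≤ m) :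
    ∃ k, 1 ≤ k ∧ p + k ≤ m + 1 ∧ (p + k = m + 1 ∨ Nat.log 2 (m + 1) ≤ k) ∧
      code g p k ≤ 4 * m + 5 ∧
      -- The flag is quantified inside, so that both readings of a block stop after the same `k`.
      ∀ f, machine.ReachesWithin w (40 * m + 51) (cfg (readBlock f) p 1 0)
        (cfg (blockEnd f) (p + k) (code g p k) 0) := by
  classical
  have hex : ∃ k, p + k = m + 1 ∨ 2 * m + 2 < p + k + code g p k :=
    ⟨m + 1 - p, Or.inl (by omega)⟩
  obtain ⟨k, hk, hmin⟩ : ∃ k, (p + k = m + 1 ∨ 2 * m + 2 < p + k + code g p k) ∧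
      ∀ j < k, ¬ (p + j = m + 1 ∨ 2 * m + 2 < p + j + code g p j) :=
    ⟨Nat.find hex, Nat.find_spec hex, fun j => Nat.find_min hex⟩
  have hk1 : 1 ≤ k := by
    rcases k with _ | k
    · simp only [code] at hk; omega
    · omega
  have hkm : p + k ≤ m + 1 := by
    by_contra hcon
    exact hmin (m + 1 - p) (by omega) (Or.inl (by omega))
  have hc : ∀ j < k, p + j + code g p j ≤ 2 * m + 2 := fun j hj => by
    have := hmin j hj
    omega
  -- The last doubling succeeded, so the code before it was at most `2 * m + 2`.
  have hcode : code g p k ≤ 4 * m + 5 := by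
    obtain ⟨j, rfl⟩ := Nat.exists_eq_add_of_le' hk1
    have := hc j (by omega)
    have := Bool.toNat_le (g (p + j))
    simp only [code]
    omega
  refine ⟨k, hk1, hkm, ?_, hcode, fun f => ?_⟩
  · refine hk.imp_right fun h => ?_
    -- As `p + k ≤ m + 1`, a full block has a code above `m + 1`, yet below `2 ^ (k + 1)`.
    have h1 := code_lt_two_pow g p k
    have h2 : Nat.log 2 (m + 1) < k + 1 := Nat.log_lt_of_lt_pow (by omega) (by omega)
    omega
  · exact ((H.readBlock_run f hp k hkm hc).trans
      (H.readBlock_end f (by omega) hkm hk)).mono (by omega)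

/-! ### Comparing a block with its mirror image -/

theorem toMiddle_run (H : Balanced w m g) (d q a b : ℕ) (hq : 1 ≤ q) (hd : q + d = m + 1) :
    machine.ReachesWithin w (d + 1) (cfg toMiddle q a b) (cfg fromMiddle (m + 1) a (b + d)) := by
  have hl := H.length
  induction d generalizing q b with
  | zero =>
    obtain rfl : q = m + 1 := hd
    exact reaches_step (by simp only [H.marker, program]; rfl) (by simp) (by omega) (by simp)
      (by simp) (by simp)
  | succ d ih =>
    have hs := H.bit q hq (by omega) (by omega)
    have h1 : machine.ReachesWithin w 1 (cfg toMiddle q a b) (cfg toMiddle (q + 1) a (b + 1)) :=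
      reaches_step (by simp only [hs, program]; rfl) (by simp) (by omega) (by simp) (by simp)
        (by simp)
    convert (h1.trans (ih (q + 1) (b + 1) (by omega) (by omega))).mono (T' := d + 1 + 1)
      (by omega) using 2
    omega

end Balanced

theorem fromMiddle_run (d p a : ℕ) (h : p + d + 1 ≤ w.length + 1) :
    machine.ReachesWithin w (d + 1) (cfg fromMiddle p a d) (cfg halve (p + d + 1) a 0) := by
  induction d generalizing p with
  | zero =>
    exact reaches_step (by simp [program]; exact ⟨rfl, rfl, rfl⟩) (by simp) (by omega) (by simp)
      (by simp) (by simp)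
  | succ d ih =>
    have h1 : machine.ReachesWithin w 1 (cfg fromMiddle p a (d + 1)) (cfg fromMiddle (p + 1) a d) :=
      reaches_step (by simp [program]; exact ⟨rfl, rfl, rfl⟩) (by simp) (by omega) (by simp)
        (by simp) (by simp)
    convert (h1.trans (ih (p + 1) (by omega))).mono (T' := d + 1 + 1) (by omega) using 2
    omega

theorem halve_run (u p a b : ℕ) (h : p ≤ w.length + 1) :
    machine.ReachesWithin w (2 * u) (cfg halve p (2 * u + a) b) (cfg halve p a (b + u)) := by
  induction u generalizing b with
  | zero => simpa using ReachesWithin.refl _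
  | succ u ih =>
    have h1 : machine.ReachesWithin w 1 (cfg halve p (2 * (u + 1) + a) b)
        (cfg halve' p (2 * u + a + 1) b) :=
      reaches_step (mv := 0) (oa := -1) (ob := 0) (by simp [program]) (by simp) h (by simp)
        (by simp; ring) (by simp)
    have h2 : machine.ReachesWithin w 1 (cfg halve' p (2 * u + a + 1) b)
        (cfg halve p (2 * u + a) (b + 1)) :=
      reaches_step (mv := 0) (oa := -1) (ob := 1) (by simp [program]) (by simp) h (by simp)
        (by simp) (by simp)
    convert ((h1.trans h2).trans (ih (b + 1))).mono (T' := 2 * (u + 1)) (by omega) using 2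
    omega

theorem copy_run (u p a : ℕ) (h : p ≤ w.length + 1) :
    machine.ReachesWithin w (u + 1) (cfg copy p a u) (cfg halve p (a + u) 0) := by
  induction u generalizing a with
  | zero =>
    exact reaches_step (mv := 0) (oa := 0) (ob := 0) (by simp [program]) (by simp) h (by simp)
      (by simp) (by simp)
  | succ u ih =>
    have h1 : machine.ReachesWithin w 1 (cfg copy p a (u + 1)) (cfg copy p (a + 1) u) :=
      reaches_step (mv := 0) (oa := 1) (ob := -1) (by simp [program]) (by simp) h (by simp)
        (by simp) (by simp)
    convert (h1.trans (ih (a + 1))).mono (T' := u + 1 + 1) (by omega) using 2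
    omega

/-- Removal of the last bit `e` of the code, when the bit `s` is scanned. -/
theorem pop_run {u p : ℕ} {e s : Bool} (hu : 1 ≤ u) (h : p ≤ w.length)
    (hs : tapeAt w p = symbol (bit s)) :
    (e = s → machine.ReachesWithin w (3 * u + 3) (cfg halve p (2 * u + e.toNat) 0)
      (cfg halve (p + 1) u 0)) ∧
    (e ≠ s → machine.Decides w (3 * u + 3) (cfg halve p (2 * u + e.toNat) 0) False) := by
  have h1 := halve_run (w := w) u p e.toNat 0 (by omega)
  rw [zero_add] at h1
  have h3 := copy_run (w := w) u (p + 1) 0 (by omega)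
  rw [zero_add] at h3
  -- A nonzero quotient distinguishes an odd code with bits left from the bare leading one.
  have hu0 : u ≠ 0 := by omega
  cases e with
  | false =>
    constructor
    · rintro rfl
      have h2 : machine.ReachesWithin w 1 (cfg halve p 0 u) (cfg copy (p + 1) 0 u) :=
        reaches_step (mv := 1) (oa := 0) (ob := 0) (by simp [program, hs]) (by simp) (by omega)
          (by simp) (by simp) (by simp)
      exact ((h1.trans h2).trans h3).mono (by omega)
    · intro hne
      obtain rfl : s = true := by simpa using hne.symm
      have h2 : machine.Decides w 0 (cfg halve p 0 u) False :=
        decides_of_stuck (by simp [program, hs]) (by simp) id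
      exact (h1.decides h2).mono (by omega)
  | true =>
    have h2 : machine.ReachesWithin w 1 (cfg halve p 1 u) (cfg halve' p 0 u) :=
      reaches_step (mv := 0) (oa := -1) (ob := 0) (by simp [program]) (by simp) (by omega)
        (by simp) (by simp) (by simp)
    constructor
    · rintro rfl
      have h2' : machine.ReachesWithin w 1 (cfg halve' p 0 u) (cfg copy (p + 1) 0 u) :=
        reaches_step (mv := 1) (oa := 0) (ob := 0) (by simp [program, hs, hu0]) (by simp)
          (by omega) (by simp) (by simp)
        (by simp)
      exact (((h1.trans h2).trans h2').trans h3).mono (by omega)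
    · intro hne
      obtain rfl : s = false := by simpa using hne.symm
      have h2' : machine.Decides w 0 (cfg halve' p 0 u) False :=
        decides_of_stuck (by simp [program, hs, hu0]) (by simp) id
      exact ((h1.trans h2).decides h2').mono (by omega)

theorem returnFromMiddle_run (d p : ℕ) (h : p + d ≤ w.length + 1) :
    machine.ReachesWithin w (d + 1) (cfg returnFromMiddle (p + d) 0 d)
      (cfg (readBlock false) p 1 0) := by
  induction d with
  | zero =>
    exact reaches_step (mv := 0) (oa := 1) (ob := 0) (by simp [program]) (by simp) (by omega)
      (by simp) (by simp) (by simp)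
  | succ d ih =>
    have h1 : machine.ReachesWithin w 1 (cfg returnFromMiddle (p + (d + 1)) 0 (d + 1))
        (cfg returnFromMiddle (p + d) 0 d) :=
      reaches_step (mv := -1) (oa := 0) (ob := -1) (by simp [program]) (by simp) (by omega)
        (by simp; omega) (by simp) (by simp)
    exact (h1.trans (ih (by omega))).mono (by omega)

theorem clear_run (a p : ℕ) (h : p ≤ w.length + 1) :
    machine.ReachesWithin w (a + 1) (cfg clear p a 0) (cfg blockStart p 0 0) := by
  induction a with
  | zero =>
    exact reaches_step (mv := 0) (oa := 0) (ob := 0) (by simp [program]) (by simp) h (by simp)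
      (by simp) (by simp)
  | succ a ih =>
    have h1 : machine.ReachesWithin w 1 (cfg clear p (a + 1) 0) (cfg clear p a 0) :=
      reaches_step (mv := 0) (oa := -1) (ob := 0) (by simp [program]) (by simp) h (by simp)
        (by simp) (by simp)
    exact (h1.trans ih).mono (by omega)

namespace Balanced

theorem returnToMiddle_run (H : Balanced w m g) (d b : ℕ) (hd : d ≤ m) :
    machine.ReachesWithin w (d + 1) (cfg returnToMiddle (m + 1 + d) 0 b)
      (cfg returnFromMiddle (m + 1) 0 (b + d)) := by
  have hl := H.length
  induction d generalizing b with
  | zero =>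
    exact reaches_step (mv := 0) (oa := 0) (ob := 0) (by simp [H.marker, program]) (by simp)
      (by omega) (by simp) (by simp)
        (by simp)
  | succ d ih =>
    have hs := H.bit (m + 1 + (d + 1)) (by omega) (by omega) (by omega)
    have h1 : machine.ReachesWithin w 1 (cfg returnToMiddle (m + 1 + (d + 1)) 0 b)
        (cfg returnToMiddle (m + 1 + d) 0 (b + 1)) :=
      reaches_step (mv := -1) (oa := 0) (ob := 1) (by simp only [hs, program]) (by simp)
        (by omega) (by simp; omega) (by simp) (by simp)
    convert (h1.trans (ih (b + 1) (by omega))).mono (T' := d + 1 + 1) (by omega) using 2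
    omega

/-- The last bit of the block pops first, and `r` is its mirror square; earlier bits have their
mirrors further right, so the head only advances. Halving makes the cost geometric. -/
theorem verify_run (H : Balanced w m g) {p : ℕ} (hp : 1 ≤ p) (k r : ℕ) (hk : p + k ≤ m + 1)
    (hr : r + p + k = 2 * m + 3) :
    ((∀ i, p ≤ i → i < p + k → g i = g (2 * m + 2 - i)) ∧
      machine.ReachesWithin w (8 * code g p k) (cfg halve r (code g p k) 0)
        (cfg returnToMiddle (2 * m + 2 - p) 0 0)) ∨
    ((¬ ∀ i, p ≤ i → i < p + k → g i = g (2 * m + 2 - i)) ∧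
      machine.Decides w (8 * code g p k) (cfg halve r (code g p k) 0) False) := by
  have hl := H.length
  induction k generalizing r with
  | zero =>
    left
    refine ⟨by omega, ?_⟩
    have h1 : machine.ReachesWithin w 1 (cfg halve r 1 0) (cfg halve' r 0 0) :=
      reaches_step (mv := 0) (oa := -1) (ob := 0) (by simp [program]) (by simp) (by omega)
        (by simp) (by simp) (by simp)
    have h2 : machine.ReachesWithin w 1 (cfg halve' r 0 0)
        (cfg returnToMiddle (2 * m + 2 - p) 0 0) :=
      reaches_step (mv := -1) (oa := 0) (ob := 0) (by simp [program]) (by simp) (by omega)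
        (by simp; omega) (by simp) (by simp)
    exact (h1.trans h2).mono (by simp [code])
  | succ k ih =>
    have hc := one_le_code g p k
    obtain ⟨hyes, hno⟩ := pop_run (w := w) (e := g (p + k)) hc (by omega)
      (H.bit r (by omega) (by omega) (by omega))
    have hrk : 2 * m + 2 - (p + k) = r := by omega
    by_cases hg : g (p + k) = g r
    · rcases ih (r + 1) (by omega) (by omega) with ⟨hall, h⟩ | ⟨hall, h⟩
      · left
        refine ⟨fun i h1 h2 => ?_, ((hyes hg).trans h).mono (by simp only [code]; omega)⟩
        rcases Nat.lt_or_ge i (p + k) with h3 | h3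
        · exact hall i h1 h3
        · obtain rfl : i = p + k := by omega
          rw [hrk, hg]
      · right
        exact ⟨fun h' => hall fun i h1 h2 => h' i h1 (by omega),
          ((hyes hg).decides h).mono (by simp only [code]; omega)⟩
    · right
      refine ⟨fun h' => hg ?_, (hno hg).mono (by simp only [code]; omega)⟩
      rw [h' (p + k) (by omega) (by omega), hrk]

/-! ### One round of the machine, and all rounds together -/

theorem block_run (H : Balanced w m g) {p : ℕ} (hp : 1 ≤ p) (hpm : p ≤ m) :
    ∃ k, 1 ≤ k ∧ p + k ≤ m + 1 ∧ (p + k = m + 1 ∨ Nat.log 2 (m + 1) ≤ k) ∧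
      (((∀ i, p ≤ i → i < p + k → g i = g (2 * m + 2 - i)) ∧
        machine.ReachesWithin w (160 * (m + 1)) (cfg blockStart p 0 0)
          (cfg blockStart (p + k) 0 0)) ∨
      ((¬ ∀ i, p ≤ i → i < p + k → g i = g (2 * m + 2 - i)) ∧
        machine.Decides w (160 * (m + 1)) (cfg blockStart p 0 0) False)) := by
  have hl := H.length
  obtain ⟨k, hk1, hkm, hlog, hcode, hread⟩ := H.exists_block hp hpm
  refine ⟨k, hk1, hkm, hlog, ?_⟩
  have h1 : machine.ReachesWithin w 1 (cfg blockStart p 0 0) (cfg (readBlock true) p 1 0) :=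
    reaches_step (mv := 0) (oa := 1) (ob := 0)
      (by simp only [H.bit p hp (by omega) (by omega), program]) (by simp) (by omega) (by simp)
      (by simp) (by simp)
  obtain ⟨d, hd⟩ : ∃ d, p + k + d = m + 1 := ⟨m + 1 - (p + k), by omega⟩
  have h2 := H.toMiddle_run d (p + k) (code g p k) 0 (by omega) hd
  rw [zero_add] at h2
  have h3 := fromMiddle_run (w := w) d (m + 1) (code g p k) (by omega)
  have h123 := ((h1.trans (hread true)).trans h2).trans h3
  rcases H.verify_run hp k (m + 1 + d + 1) hkm (by omega) with ⟨hall, h⟩ | ⟨hall, h⟩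
  · left
    refine ⟨hall, ?_⟩
    obtain ⟨c, hc⟩ : ∃ c, p + c = m + 1 := ⟨m + 1 - p, by omega⟩
    have h4 := H.returnToMiddle_run c 0 (by omega)
    rw [show m + 1 + c = 2 * m + 2 - p by omega, zero_add, ← hc] at h4
    have h5 := returnFromMiddle_run (w := w) c p (by omega)
    have h6 := clear_run (w := w) (code g p k) (p + k) (by omega)
    exact (((((h123.trans h).trans h4).trans h5).trans (hread false)).trans h6).mono (by omega)
  · right
    exact ⟨hall, (h123.decides h).mono (by omega)⟩

theorem blockStart_marker (H : Balanced w m g) {P : Prop} (hP : P) :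
    machine.Decides w 1 (cfg blockStart (m + 1) 0 0) P := by
  have hl := H.length
  have h1 : machine.ReachesWithin w 1 (cfg blockStart (m + 1) 0 0) (cfg accepting (m + 1) 0 0) :=
    reaches_step (mv := 0) (oa := 0) (ob := 0) (by simp only [H.marker, program]) (by simp)
      (by omega) (by simp) (by simp)
        (by simp)
  exact h1.decides (decides_accept (T := 0) hP)

/-- Each block that stops short of the marker lowers the quotient by at least one; the summand 1
pays for a final block, which may be short. -/
theorem blocks_run (H : Balanced w m g) (r p : ℕ) (hp : 1 ≤ p) (hr : p + r = m + 1) :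
    machine.Decides w (160 * (m + 1) * (r / Nat.log 2 (m + 1) + 1) + 1) (cfg blockStart p 0 0)
      (∀ i, p ≤ i → i < m + 1 → g i = g (2 * m + 2 - i)) := by
  induction r using Nat.strong_induction_on generalizing p with
  | _ r ih =>
    rcases Nat.eq_zero_or_pos r with rfl | hpos
    · obtain rfl : p = m + 1 := hr
      exact (H.blockStart_marker (by omega)).mono (by omega)
    obtain ⟨k, hk1, hkm, hlog, ⟨hall, h⟩ | ⟨hall, h⟩⟩ := H.block_run hp (by omega)
    · by_cases hlast : p + k = m + 1
      · rw [hlast] at h hall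
        exact (h.decides (H.blockStart_marker hall)).mono
          (by nlinarith [Nat.zero_le (r / Nat.log 2 (m + 1))])
      · have hlogk := hlog.resolve_left hlast
        have hK : 0 < Nat.log 2 (m + 1) := Nat.log_pos (by omega) (by omega)
        -- This is where the logarithmic block length enters.
        have hdiv : (r - k) / Nat.log 2 (m + 1) + 1 ≤ r / Nat.log 2 (m + 1) := by
          rw [← Nat.add_div_right _ hK]
          exact Nat.div_le_div_right (by omega)
        have h' := ih (r - k) (by omega) (p + k) (by omega) (by omega)
        refine ((h.decides h').mono ?_).congr ⟨fun h i h1 h2 => ?_, fun h i h1 h2 => ?_⟩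
        · have := Nat.mul_le_mul_left (160 * (m + 1)) hdiv
          linarith
        · rcases Nat.lt_or_ge i (p + k) with h3 | h3
          · exact hall i h1 h3
          · exact h i h3 h2
        · exact h i (by omega) h2
    · refine (h.mono ?_).congr (iff_of_false id fun h => hall fun i h1 h2 => h i h1 (by omega))
      nlinarith [Nat.zero_le (r / Nat.log 2 (m + 1))]

end Balanced

/-! ### The time bound -/

/-- The time bound for inputs of length `n`. -/
def timeBound (n : ℕ) : ℕ := 200 * (n + 1) * (n / Nat.log 2 (n / 2 + 1) + 2)

/-- Pays for inputs already rejected by the check of their shape. -/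
theorem le_timeBound (n : ℕ) : 2 * n + 2 ≤ timeBound n := by
  unfold timeBound
  nlinarith [Nat.zero_le (n / Nat.log 2 (n / 2 + 1))]

theorem machine_decides (w : List MarkedBit) :
    machine.Decides w (timeBound w.length) machine.init (w ∈ markedPalindromes) := by
  have htb := le_timeBound w.length
  rw [init_eq]
  rcases countLeft_run w [] 0 rfl with ⟨x, r, hw, h1⟩ | ⟨hw, h1⟩
  · have hlen : w.length = x.length + 1 + r.length := by simp [hw]; omega
    rcases countRight_run (w := w) r (x.map bit ++ [marker]) x.length (by simp [hw]) with
      ⟨y, rfl, hy, h2⟩ | ⟨hr, h2⟩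
    · obtain ⟨g, H, hmem⟩ := exists_balanced hy
      rw [← hw] at H hmem
      have h3 := rewind_run (w := w) w.length le_rfl
      have h4 := H.blocks_run x.length 1 le_rfl (by omega)
      simp only [List.length_nil, List.length_append, List.length_map, List.length_singleton,
        zero_add] at h1 h2
      refine ((((h1.trans h2).trans h3).decides h4).mono ?_).congr hmem.symm
      have hl := H.length
      -- For balanced inputs, `n / 2` in `timeBound` is exactly `m`.
      have hhalf : w.length / 2 = x.length := by omega
      have hdiv : x.length / Nat.log 2 (x.length + 1) ≤
          w.length / Nat.log 2 (x.length + 1) := Nat.div_le_div_right (by omega)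
      rw [timeBound, hhalf]
      generalize x.length / Nat.log 2 (x.length + 1) = A at *
      generalize w.length / Nat.log 2 (x.length + 1) = B at *
      have : 160 * (x.length + 1) * (A + 1) ≤ 160 * (x.length + 1) * (B + 1) := by gcongr
      rw [hl]
      nlinarith [Nat.zero_le (x.length * B)]
    · simp only [List.length_nil, List.length_append, List.length_map, List.length_singleton,
        zero_add] at h1 h2
      refine ((h1.decides h2).mono (by omega)).congr (iff_of_false id fun hmem => hr ?_)
      rw [hw, mem_markedPalindromes_iff] at hmem
      exact ⟨x.reverse, hmem, by simp⟩
  · refine (h1.mono (by omega)).congr (iff_of_false id ?_)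
    rintro ⟨x, rfl⟩
    simp at hw

theorem timeBound_isBigO :
    (fun n : ℕ => (timeBound n : ℝ)) =O[atTop]
      (fun n : ℕ => (n : ℝ) ^ 2 / Real.log (n : ℝ)) := by
  refine IsBigO.of_bound 2000 ?_
  filter_upwards [eventually_ge_atTop 2] with n hn
  set K := Nat.log 2 (n / 2 + 1) with hKdef
  have hK : 1 ≤ K := Nat.log_pos (by omega) (by omega)
  have hn' : (2 : ℝ) ≤ n := by exact_mod_cast hn
  have hlogpos : 0 < Real.log n := Real.log_pos (by linarith)
  have hlogle : Real.log n ≤ n := (Real.log_le_sub_one_of_pos (by linarith)).trans (by linarith)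
  -- Rounding gives `n ≤ 2 ^ (K + 2)`; then `log 2 ≤ 1` and `K + 2 ≤ 3 * K`.
  have hlogK : Real.log n ≤ 3 * K := by
    have h1 : n / 2 + 1 < 2 ^ (K + 1) := Nat.lt_pow_succ_log_self (by omega) _
    have h2 : n ≤ 2 ^ (K + 2) := by rw [pow_succ]; omega
    have h3 : Real.log n ≤ Real.log ((2 : ℝ) ^ (K + 2)) :=
      Real.log_le_log (by linarith) (by exact_mod_cast h2)
    rw [Real.log_pow] at h3
    have h4 : Real.log 2 ≤ 1 := by linarith [Real.log_two_lt_d9]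
    have h5 : (1 : ℝ) ≤ K := by exact_mod_cast hK
    have h6 : ((K + 2 : ℕ) : ℝ) * Real.log 2 ≤ ((K + 2 : ℕ) : ℝ) * 1 := by gcongr
    push_cast at h3 h6
    linarith
  have hKpos : (0 : ℝ) < K := by exact_mod_cast hK
  have hdiv : ((n / K : ℕ) : ℝ) ≤ 3 * (n / Real.log n) := by
    refine Nat.cast_div_le.trans ?_
    rw [← mul_div_assoc, div_le_div_iff₀ hKpos hlogpos]
    nlinarith
  have htwo : (2 : ℝ) ≤ 2 * (n / Real.log n) := by
    have : 1 ≤ n / Real.log n := (one_le_div hlogpos).2 hlogle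
    linarith
  rw [Real.norm_of_nonneg (by positivity), Real.norm_of_nonneg (by positivity)]
  calc (timeBound n : ℝ) = 200 * (n + 1) * (((n / K : ℕ) : ℝ) + 2) := by
        rw [timeBound, ← hKdef]; push_cast; ring
    -- Uses `n + 1 ≤ 2 * n`, `hdiv` and `htwo`; the constant is 200 · 2 · (3 + 2) = 2000.
    _ ≤ 200 * (2 * n) * (3 * (n / Real.log n) + 2 * (n / Real.log n)) := by
        gcongr; linarith
    _ = 2000 * ((n : ℝ) ^ 2 / Real.log n) := by ring

end MarkedPalindrome

theorem mainTheorem4 :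
    ∃ (M : CounterMachine 2 MarkedBit) (t : ℕ → ℕ),
      M.language = markedPalindromes ∧
      M.RunsInTime t ∧
      (fun n : ℕ => (t n : ℝ)) =O[atTop] (fun n : ℕ => (n : ℝ) ^ 2 / Real.log (n : ℝ)) := by
  refine ⟨MarkedPalindrome.machine, MarkedPalindrome.timeBound, ?_, fun w => ?_,
    MarkedPalindrome.timeBound_isBigO⟩
  · ext w
    exact (MarkedPalindrome.machine_decides w).accepts_iff
  · exact (MarkedPalindrome.machine_decides w).haltsWithin
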